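/- **Setting.** Let $M$ be a compact Riemannian $3$-manifold (possibly with boundary) with Riemannian distance $d_M$ (finite, so $M$ is connected), and let $A_0\subset M$ be nonempty and compact. For $\delta>0$ let $A_\delta=\{x\in M:\ d_M(x,A_0)<\delta\}$. Volumes are $3$-dimensional Hausdorff measures. *Pulled space.* $N_\infty=(M\setminus A_0)\sqcup\{p_0\}$ with the metric $d_\infty(x,p_0)=\min_{y\in A_0}d_M(x,y)$ and, for $x_1,x_2\in M\setminus A_0$, $$d_\infty(x_1,x_2)=\min\Big\{d_M(x_1,x_2),\ \min_{y_1,y_2\in A_0}\big(d_M(x_1,y_1)+d_M(x_2,y_2)\big)\Big\}.$$ *Scrunching sequence.* Let $N_j$ ($j\in\mathbb N$) be nonempty compact Riemannian $3$-manifolds (possibly with boundary) with finite Riemannian distances $d_j$, and let $A'_j\subset N_j$ be such that $N_j=(M\setminus A_{\delta_j})\sqcup A'_j$. That is, $\delta_j>0$, there is a Riemannian isometry $e_j$ of $M\setminus A_{\delta_j}$ onto $N_j\setminus A'_j$ (a bijection, smooth in both directions, whose differential at each point is a linear isometry), and $A'_j$ is glued along the boundary: $\partial A'_j=e_j(\partial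 A_{\delta_j})$. Suppose that the $N_j$ scrunch $A_0$ to a point, i.e. there are real numbers $\epsilon_j\to0$ and $H_j\to0$ with $2\delta_j<H_j$ and $$(1-\epsilon_j)\operatorname{Vol}(A_{\delta_j})\le\operatorname{Vol}(A'_j)\le(1+\epsilon_j)\operatorname{Vol}(A_{\delta_j}),$$ $$(1-\epsilon_j)\operatorname{Vol}(M)\le\operatorname{Vol}(N_j)\le(1+\epsilon_j)\operatorname{Vol}(M),\qquad \operatorname{Diam}(A'_j)\le H_j .$$ *The maps.* Let $\pi:M\to N_\infty$ be the projection (the identity off $A_0$, constantly $p_0$ on $A_0$) and $P_j=\pi\circ e_j^{-1}:N_j\setminus A'_j\to N_\infty$. Let $T_{\delta_j}(A'_j)=\{x\in N_j:\ d_j(x,A'_j)<\delta_j\}$. Consider maps $F_j:N_j\to N_\infty$ with $$F_j(x)=\begin{cases}P_j(x), & x\notin T_{\delta_j}(A'_j),\\ p_0, & x\in A'_j,\\ \gamma_q\big((d_\infty(p_0,q)-\delta_j)/\delta_j\big),\ q=P_j(x), & x\in T_{\delta_j}(A'_j)\setminus A'_j,\end{cases}$$ where $\gamma_q:[0,1]\to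 N_\infty$ is a minimal geodesic from $p_0$ to $q$, parametrized proportionally to arclength. **Lemma.** For every $j$ such a map $F_j$ exists, and every such map is an $\eta_j$-almost isometry with $\eta_j=H_j+2\delta_j<2H_j$, that is, $$|d_\infty(F_j(x),F_j(y))-d_j(x,y)|\le\eta_j\quad\text{for all }x,y\in N_j,\qquad N_\infty\subset T_{\eta_j}(F_j(N_j)),$$ where $T_\eta$ denotes the open $\eta$-neighbourhood in $N_\infty$. Moreover $\lim_{j\to\infty}\eta_j=0$, and $N_j\to N_\infty$ in the Gromov–Hausdorff sense, i.e. $d_{GH}(N_j,N_\infty)\to0$. -/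

import Mathlib

open Set Filter Topology MeasureTheory TopologicalSpace
open scoped Manifold ContDiff MeasureTheory Bundle

/-! ### The space obtained by pulling a compact set to a point -/

/-- The underlying set `X \ K ⊔ {p₀}` of the space obtained from `X` by pulling the nonempty
compact set `K` to a point; the point `p₀` is `none`. -/
def PulledSpace {X : Type*} [MetricSpace X] (K : NonemptyCompacts X) : Type _ :=
  Option {x : X // x ∉ K}

namespace PulledSpace

variable {X : Type*} [MetricSpace X] (K : NonemptyCompacts X)

/-- The point to which `K` is pulled. -/
def basePoint : PulledSpace K := (none : Option {x : X // x ∉ K})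

open Classical in
/-- The canonical projection `X → X \ K ⊔ {p₀}`: the identity off `K`, and constant on `K`. -/
noncomputable def proj (x : X) : PulledSpace K :=
  if h : x ∈ K then basePoint K else (some ⟨x, h⟩ : Option {x : X // x ∉ K})

variable {K} in
/-- The distance: `d(x, p₀) = min_{y ∈ K} d(x, y)` and
`d(x₁, x₂) = min (d(x₁, x₂), min_{y₁, y₂ ∈ K} (d(x₁, y₁) + d(x₂, y₂)))` for `x₁, x₂ ∉ K`.
Here `Metric.infDist x K` is the minimum of `d(x, y)` over `y ∈ K`, as `K` is compact. -/
noncomputable def pulledDist : PulledSpace K → PulledSpace K → ℝ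
  | none, none => 0
  | none, some x => Metric.infDist x.1 (K : Set X)
  | some x, none => Metric.infDist x.1 (K : Set X)
  | some x₁, some x₂ =>
      min (dist x₁.1 x₂.1) (Metric.infDist x₁.1 (K : Set X) + Metric.infDist x₂.1 (K : Set X))

theorem infDist_pos (x : {x : X // x ∉ K}) : 0 < Metric.infDist x.1 (K : Set X) :=
  (K.isCompact.isClosed.notMem_iff_infDist_pos K.nonempty).1 x.2

noncomputable instance : MetricSpace (PulledSpace K) where
  dist := pulledDist
  dist_self x := by
    rcases x with _ | x
    · rfl
    · change min (dist x.1 x.1) _ = 0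
      rw [dist_self, min_eq_left]
      have := infDist_pos K x
      linarith
  dist_comm x y := by
    rcases x with _ | x <;> rcases y with _ | y
    · rfl
    · rfl
    · rfl
    · change min _ _ = min _ _
      rw [dist_comm, add_comm]
  dist_triangle x y z := by
    have t (a b : {x : X // x ∉ K}) :
        Metric.infDist a.1 (K : Set X) ≤ Metric.infDist b.1 (K : Set X) + dist a.1 b.1 :=
      Metric.infDist_le_infDist_add_dist
    rcases x with _ | x <;> rcases y with _ | y <;> rcases z with _ | z
    · change (0 : ℝ) ≤ 0 + 0
      simp
    · change Metric.infDist z.1 (K : Set X) ≤ 0 + Metric.infDist z.1 (K : Set X)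
      simp
    · change (0 : ℝ) ≤ Metric.infDist y.1 (K : Set X) + Metric.infDist y.1 (K : Set X)
      have := infDist_pos K y
      linarith
    · change Metric.infDist z.1 (K : Set X) ≤ Metric.infDist y.1 (K : Set X) + min _ _
      have h1 := infDist_pos K y
      have h2 := t z y
      rw [dist_comm] at h2
      rcases min_choice (dist y.1 z.1)
        (Metric.infDist y.1 (K : Set X) + Metric.infDist z.1 (K : Set X)) with h | h <;>
        rw [h] <;> linarith
    · change Metric.infDist x.1 (K : Set X) ≤ Metric.infDist x.1 (K : Set X) + 0
      simp
    · change min _ _ ≤ Metric.infDist x.1 (K : Set X) + Metric.infDist z.1 (K : Set X)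
      exact min_le_right _ _
    · change Metric.infDist x.1 (K : Set X) ≤ min _ _ + Metric.infDist y.1 (K : Set X)
      have h1 := infDist_pos K y
      have h2 := t x y
      rcases min_choice (dist x.1 y.1)
        (Metric.infDist x.1 (K : Set X) + Metric.infDist y.1 (K : Set X)) with h | h <;>
        rw [h] <;> linarith
    · change min _ _ ≤ min _ _ + min _ _
      have h0 := infDist_pos K y
      have h1 := t x y
      have h2 := t z y
      rw [dist_comm] at h2
      have h3 := dist_triangle x.1 y.1 z.1
      have h4 := min_le_left (dist x.1 z.1)
        (Metric.infDist x.1 (K : Set X) + Metric.infDist z.1 (K : Set X))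
      have h5 := min_le_right (dist x.1 z.1)
        (Metric.infDist x.1 (K : Set X) + Metric.infDist z.1 (K : Set X))
      rcases min_choice (dist x.1 y.1)
        (Metric.infDist x.1 (K : Set X) + Metric.infDist y.1 (K : Set X)) with h | h <;>
      rcases min_choice (dist y.1 z.1)
        (Metric.infDist y.1 (K : Set X) + Metric.infDist z.1 (K : Set X)) with h' | h' <;>
        rw [h, h'] <;> linarith
  eq_of_dist_eq_zero {x y} hxy := by
    rcases x with _ | x <;> rcases y with _ | y
    · rfl
    · exact absurd hxy (infDist_pos K y).ne'
    · exact absurd hxy (infDist_pos K x).ne'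
    · change min _ _ = (0 : ℝ) at hxy
      have h1 := infDist_pos K x
      have h2 := infDist_pos K y
      rcases min_choice (dist x.1 y.1)
        (Metric.infDist x.1 (K : Set X) + Metric.infDist y.1 (K : Set X)) with h | h
      · rw [h] at hxy
        exact congrArg some (Subtype.ext (dist_eq_zero.1 hxy))
      · rw [h] at hxy
        linarith

instance : Nonempty (PulledSpace K) := ⟨basePoint K⟩

theorem proj_of_mem {x : X} (h : x ∈ K) : proj K x = basePoint K := dif_pos h

theorem proj_of_notMem {x : X} (h : x ∉ K) :
    proj K x = (some ⟨x, h⟩ : Option {x : X // x ∉ K}) := dif_neg h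

theorem dist_proj_le (x y : X) : dist (proj K x) (proj K y) ≤ dist x y := by
  by_cases hx : x ∈ K <;> by_cases hy : y ∈ K
  · rw [proj_of_mem K hx, proj_of_mem K hy, dist_self]
    exact dist_nonneg
  · rw [proj_of_mem K hx, proj_of_notMem K hy, dist_comm x y]
    exact Metric.infDist_le_dist_of_mem hx
  · rw [proj_of_notMem K hx, proj_of_mem K hy]
    exact Metric.infDist_le_dist_of_mem hy
  · rw [proj_of_notMem K hx, proj_of_notMem K hy]
    exact min_le_left _ _

theorem proj_surjective : Function.Surjective (proj K) := by
  rintro (_ | x)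
  · obtain ⟨p, hp⟩ := K.nonempty
    exact ⟨p, dif_pos hp⟩
  · exact ⟨x.1, dif_neg x.2⟩

instance [CompactSpace X] : CompactSpace (PulledSpace K) := by
  have hc : Continuous (proj K) :=
    (LipschitzWith.of_dist_le_mul (K := 1) fun x y => by
      simpa using dist_proj_le K x y).continuous
  exact ⟨by
    rw [← (proj_surjective K).range_eq]
    exact isCompact_range hc⟩

end PulledSpace

/-! ### Almost isometries and minimal geodesics in metric spaces -/

/-- `F : X → Y` is an `η`-almost isometry: it distorts distances by at most `η`, and `Y` is
contained in the (open) `η`-tubular neighbourhood of the image of `F`. -/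
def IsAlmostIsometry {X Y : Type*} [MetricSpace X] [MetricSpace Y] (η : ℝ) (F : X → Y) : Prop :=
  (∀ p q : X, |dist (F p) (F q) - dist p q| ≤ η) ∧ ∀ y : Y, y ∈ Metric.thickening η (range F)

/-- `γ`, restricted to `[0,1]`, is a minimal geodesic from `p` to `q`, parametrized
proportionally to arclength. -/
def IsMinimalGeodesic {Y : Type*} [MetricSpace Y] (γ : ℝ → Y) (p q : Y) : Prop :=
  γ 0 = p ∧ γ 1 = q ∧
    ∀ s ∈ Icc (0 : ℝ) 1, ∀ t ∈ Icc (0 : ℝ) 1, dist (γ s) (γ t) = |s - t| * dist p q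

/-! ### Replacing a region of a Riemannian manifold -/

section Scrunch

variable {H : Type*} [TopologicalSpace H]
  (I : ModelWithCorners ℝ (EuclideanSpace ℝ (Fin 3)) H)
  {M : Type*} [MetricSpace M] [ChartedSpace H M]
  [Bundle.RiemannianBundle (fun x : M => TangentSpace I x)]

/-- `N = (M \ A) ⊔ A'`: the partial bijection `e` is a Riemannian isometry of `M \ A` onto
`N \ A'` (it is smooth with smooth inverse, and its differential at each point is a linear
isometry), and `A'` is glued to `M \ A` exactly along the boundary of `A`. Smoothness and
differentials are taken within the set `M \ A`. -/
structure IsReplacement {N : Type*} [MetricSpace N] [ChartedSpace H N]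
    [Bundle.RiemannianBundle (fun x : N => TangentSpace I x)]
    (A : Set M) (A' : Set N) (e : PartialEquiv M N) : Prop where
  source_eq : e.source = Aᶜ
  target_eq : e.target = A'ᶜ
  contMDiffOn : ContMDiffOn I I ∞ e e.source
  contMDiffOn_symm : ContMDiffOn I I ∞ e.symm e.target
  isometric : ∀ x ∈ e.source, ∃ L : TangentSpace I x →L[ℝ] TangentSpace I (e x),
    HasMFDerivWithinAt I I e e.source x L ∧ ∀ v, ‖L v‖ = ‖v‖
  frontier_eq : frontier A' = e '' frontier A

/-- The sequence of manifolds `N j = (M \ A_{δ j}) ⊔ A' j`, where `A_δ` is the open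
`δ`-tubular neighbourhood of `A₀`, scrunches `A₀` down to a point: up to factors `1 ± ε j`, the
volumes of `A' j` and `N j` are those of `A_{δ j}` and `M`, and `A' j` has diameter at most `D j`,
where `ε j → 0`, `D j → 0` and `2 δ j < D j`. Volumes are three-dimensional Hausdorff
measures. -/
structure IsScrunching [MeasurableSpace M] [BorelSpace M] (A₀ : NonemptyCompacts M)
    {N : ℕ → Type*} [∀ j, MetricSpace (N j)] [∀ j, ChartedSpace H (N j)]
    [∀ j, Bundle.RiemannianBundle (fun x : N j => TangentSpace I x)]
    [∀ j, MeasurableSpace (N j)] [∀ j, BorelSpace (N j)]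
    (A' : ∀ j, Set (N j)) (e : ∀ j, PartialEquiv M (N j)) (δ ε D : ℕ → ℝ) : Prop where
  delta_pos : ∀ j, 0 < δ j
  replacement : ∀ j, IsReplacement I (Metric.thickening (δ j) (A₀ : Set M)) (A' j) (e j)
  le_vol_region : ∀ j, ENNReal.ofReal (1 - ε j) * μH[3] (Metric.thickening (δ j) (A₀ : Set M))
    ≤ μH[3] (A' j)
  vol_region_le : ∀ j, μH[3] (A' j)
    ≤ μH[3] (Metric.thickening (δ j) (A₀ : Set M)) * ENNReal.ofReal (1 + ε j)
  le_vol : ∀ j, ENNReal.ofReal (1 - ε j) * μH[3] (univ : Set M) ≤ μH[3] (univ : Set (N j))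
  vol_le : ∀ j, μH[3] (univ : Set (N j)) ≤ μH[3] (univ : Set M) * ENNReal.ofReal (1 + ε j)
  diam_le : ∀ j, Metric.diam (A' j) ≤ D j
  tendsto_eps : Tendsto ε atTop (𝓝 0)
  tendsto_diam : Tendsto D atTop (𝓝 0)
  two_delta_lt : ∀ j, 2 * δ j < D j

end Scrunch

/-- The map `P : N \ A' → N_∞`, `N_∞` being `M` with `A₀` pulled to a point: the identification
of `N \ A'` with `M \ A_δ`, followed by the projection of `M`. -/
noncomputable def regionMap {M N : Type*} [MetricSpace M] (A₀ : NonemptyCompacts M)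
    (e : PartialEquiv M N) (x : N) : PulledSpace A₀ :=
  PulledSpace.proj A₀ (e.symm x)

/-- The maps `F : N → N_∞` of the construction: `F = P` off the `δ`-tubular neighbourhood of `A'`,
`F = p₀` on `A'`, and in between `F x = γ_q ((d(p₀, q) - δ) / δ)`, where `q = P x` and `γ_q` is
a minimal geodesic from `p₀` to `q`. -/
structure IsScrunchMap {M N : Type*} [MetricSpace M] [MetricSpace N] (A₀ : NonemptyCompacts M)
    (A' : Set N) (e : PartialEquiv M N) (δ : ℝ) (F : N → PulledSpace A₀) : Prop where
  outer : ∀ x, x ∉ Metric.thickening δ A' → F x = regionMap A₀ e x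
  inner : ∀ x ∈ A', F x = PulledSpace.basePoint A₀
  between : ∀ x ∈ Metric.thickening δ A' \ A', ∃ γ : ℝ → PulledSpace A₀,
    IsMinimalGeodesic γ (PulledSpace.basePoint A₀) (regionMap A₀ e x) ∧
    F x = γ ((dist (PulledSpace.basePoint A₀) (regionMap A₀ e x) - δ) / δ)

/-! Off `A'` the map `F` differs from the projection `P = regionMap A₀ e` by at most `δ`, so the
distortion reduces to two estimates: `d_∞(Px, Py) ≤ d(x, y) + 2δ` (`dist_regionMap_le`) and `d(x, y)
≤ d_∞(Px, Py) + D` (`dist_le_dist_regionMap`). Both follow nearly minimizing paths. A path that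
avoids the replaced region is carried to the other manifold with the same length. Any other path is
cut at its first entrance, which lies on a frontier: in `M` that frontier is within `δ` of `A₀`, and
in `N` it lies in the closure of `A'`, of diameter at most `D`.

The two moves by `δ` give the errors `4δ` and `D + 2δ`; since `2δ < D`, both are at most `D + 2δ`.
The maps exist because minimal geodesics exist in the compact manifold `M`
(`exists_isMinimalGeodesic`) and those that start at a nearest point of `A₀` project to minimal
geodesics. -/

theorem dist_add_dist_lt_of_edist {X Y : Type*} [MetricSpace X] [MetricSpace Y] {x y : X}
    {z w : Y} {r : ℝ} (h : edist x y + edist z w < ENNReal.ofReal r) :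
    dist x y + dist z w < r := by
  rw [edist_dist, edist_dist, ← ENNReal.ofReal_add dist_nonneg dist_nonneg] at h
  exact (ENNReal.ofReal_lt_ofReal_iff_of_nonneg (by positivity)).1 h

/-- The first time at which a path that starts outside an open set enters it. -/
theorem exists_first_entrance {X : Type*} [TopologicalSpace X] {U : Set X} (hU : IsOpen U)
    {γ : ℝ → X} (hγ : ContinuousOn γ (Icc 0 1)) (h0 : γ 0 ∉ U) {b : ℝ} (hb : b ∈ Icc (0 : ℝ) 1)
    (hbU : γ b ∈ U) :
    ∃ t ∈ Icc 0 b, MapsTo γ (Icc 0 t) Uᶜ ∧ γ t ∈ frontier U := by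
  set S : Set ℝ := {t | t ∈ Icc 0 b ∧ γ t ∈ U} with hS
  have hbS : b ∈ S := ⟨⟨hb.1, le_rfl⟩, hbU⟩
  have hbdd : BddBelow S := ⟨0, fun t ht => ht.1.1⟩
  set t := sInf S with ht
  have h0t : 0 ≤ t := le_csInf ⟨b, hbS⟩ fun s hs => hs.1.1
  have htb : t ≤ b := csInf_le hbdd hbS
  have hlt : ∀ s ∈ Ico 0 t, γ s ∈ Uᶜ := fun s hs hsU =>
    absurd (csInf_le hbdd (show s ∈ S from ⟨⟨hs.1, hs.2.le.trans htb⟩, hsU⟩)) (not_le.2 hs.2)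
  have htm : t ∈ Icc (0 : ℝ) 1 := ⟨h0t, htb.trans hb.2⟩
  -- `Uᶜ` is closed, so it contains the limit from the left; at `t = 0` there is no left side and
  -- `h0` is used.
  have htU : γ t ∉ U := by
    rcases h0t.eq_or_lt with h | h
    · rwa [← h]
    · have hcl : t ∈ closure (Ico 0 t) := by
        rw [closure_Ico h.ne]
        exact ⟨h0t, le_rfl⟩
      have := (((hγ t htm).mono (Ico_subset_Icc_self.trans
        (Icc_subset_Icc_right htm.2))).mem_closure_image hcl)
      exact closure_minimal (MapsTo.image_subset fun s hs => hlt s hs) hU.isClosed_compl this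
  refine ⟨t, ⟨h0t, htb⟩, fun s hs => ?_, ?_⟩
  · rcases hs.2.eq_or_lt with h | h
    · rwa [h]
    · exact hlt s ⟨hs.1, h⟩
  · rw [hU.frontier_eq]
    refine ⟨?_, htU⟩
    have hcl : t ∈ closure S := csInf_mem_closure ⟨b, hbS⟩ hbdd
    have := ((hγ t htm).mono (show S ⊆ Icc 0 1 from
      fun s hs => ⟨hs.1.1, hs.1.2.trans hb.2⟩)).mem_closure_image hcl
    exact closure_mono (image_subset_iff.2 fun s hs => hs.2) this

/-! ### Transport of paths through a Riemannian isometry of closed pieces -/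

section RiemannianPaths

open Manifold

variable {H : Type*} [TopologicalSpace H]
  {I : ModelWithCorners ℝ (EuclideanSpace ℝ (Fin 3)) H}
  {M : Type*} [MetricSpace M] [ChartedSpace H M]
  [Bundle.RiemannianBundle (fun x : M => TangentSpace I x)]
  {N : Type*} [MetricSpace N] [ChartedSpace H N]
  [Bundle.RiemannianBundle (fun x : N => TangentSpace I x)]

/-- A map that carries `C¹` paths in `s` to `C¹` paths of the same length. -/
def PreservesPathLengthOn (I : ModelWithCorners ℝ (EuclideanSpace ℝ (Fin 3)) H)
    {M : Type*} [MetricSpace M] [ChartedSpace H M]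
    [Bundle.RiemannianBundle (fun x : M => TangentSpace I x)]
    {N : Type*} [MetricSpace N] [ChartedSpace H N]
    [Bundle.RiemannianBundle (fun x : N => TangentSpace I x)] (f : M → N) (s : Set M) : Prop :=
  ∀ (γ : ℝ → M) (a b : ℝ), a ≤ b → CMDiff[Icc a b] 1 γ → MapsTo γ (Icc a b) s →
    CMDiff[Icc a b] 1 (f ∘ γ) ∧ pathELength I (f ∘ γ) a b = pathELength I γ a b

/-- By the chain rule the speed is unchanged at each time. Derivatives need to be unique only within
the time interval, so `s` may have an irregular boundary; this is why a one-point interval is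
treated apart. -/
theorem preservesPathLengthOn_of_isometric {f : M → N} {s : Set M}
    (hf : ContMDiffOn I I ∞ f s)
    (hiso : ∀ x ∈ s, ∃ L : TangentSpace I x →L[ℝ] TangentSpace I (f x),
      HasMFDerivWithinAt I I f s x L ∧ ∀ v, ‖L v‖ = ‖v‖) :
    PreservesPathLengthOn I f s := by
  intro γ a b hab hγ hs
  refine ⟨(hf.of_le (by simp)).comp hγ hs, ?_⟩
  rcases hab.eq_or_lt with rfl | hab
  · simp
  simp only [pathELength_eq_lintegral_mfderivWithin_Icc]
  refine setLIntegral_congr_fun measurableSet_Icc fun t ht => ?_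
  obtain ⟨L, hL, hn⟩ := hiso (γ t) (hs ht)
  have h1 := ((hγ.mdifferentiableOn one_ne_zero) t ht).hasMFDerivWithinAt
  have hu : UniqueMDiffWithinAt 𝓘(ℝ, ℝ) (Icc a b) t :=
    (uniqueDiffOn_Icc hab t ht).uniqueMDiffWithinAt
  have h2 := (hL.comp t h1 hs).mfderivWithin hu
  simp only [h2]
  have h3 := hn (mfderiv[Icc a b] γ t 1)
  simp only [← ofReal_norm]
  exact congrArg ENNReal.ofReal h3

theorem PreservesPathLengthOn.symm {e : PartialEquiv M N}
    (he : PreservesPathLengthOn I e e.source) (hs : ContMDiffOn I I ∞ e.symm e.target) :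
    PreservesPathLengthOn I e.symm e.target := by
  intro γ a b hab hγ hm
  have h1 : CMDiff[Icc a b] 1 (e.symm ∘ γ) := (hs.of_le (by simp)).comp hγ hm
  refine ⟨h1, ?_⟩
  rw [← (he _ a b hab h1 fun t ht => e.map_target (hm ht)).2]
  exact pathELength_congr fun t ht => e.right_inv (hm ht)

variable [IsRiemannianManifold I M] [IsRiemannianManifold I N]

theorem exists_path_of_dist_lt {H : Type*} [TopologicalSpace H]
    (I : ModelWithCorners ℝ (EuclideanSpace ℝ (Fin 3)) H)
    {M : Type*} [MetricSpace M] [ChartedSpace H M]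
    [Bundle.RiemannianBundle (fun x : M => TangentSpace I x)] [IsRiemannianManifold I M]
    {x y : M} {r : ℝ} (h : dist x y < r) :
    ∃ γ : ℝ → M, γ 0 = x ∧ γ 1 = y ∧ CMDiff[Icc 0 1] 1 γ ∧
      pathELength I γ 0 1 < ENNReal.ofReal r := by
  apply exists_lt_of_riemannianEDist_lt
  rw [← IsRiemannianManifold.out (I := I), edist_dist]
  exact (ENNReal.ofReal_lt_ofReal_iff_of_nonneg dist_nonneg).2 h

theorem edist_le_pathELength {γ : ℝ → M} {a b : ℝ} (hab : a ≤ b) (hγ : CMDiff[Icc a b] 1 γ) :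
    edist (γ a) (γ b) ≤ pathELength I γ a b := by
  rw [IsRiemannianManifold.out (I := I)]
  exact riemannianEDist_le_pathELength hγ rfl rfl hab

/-- A nearly minimizing path is cut at its first entrance into `U`: only the initial piece, which
lies in `Uᶜ`, is carried by `f`. -/
theorem PreservesPathLengthOn.exists_mem_frontier {f : M → N} {U : Set M}
    (hf : PreservesPathLengthOn I f Uᶜ) (hU : IsOpen U) {x y : M} (hx : x ∉ U) (hy : y ∈ U)
    {r : ℝ} (h : dist x y < r) :
    ∃ a ∈ frontier U, dist (f x) (f a) + dist a y < r := by
  obtain ⟨γ, rfl, rfl, hγ, hr⟩ := exists_path_of_dist_lt I h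
  obtain ⟨t, ht, hm, hfr⟩ := exists_first_entrance hU hγ.continuousOn hx (b := 1) (by simp) hy
  refine ⟨γ t, hfr, dist_add_dist_lt_of_edist (lt_of_le_of_lt ?_ hr)⟩
  obtain ⟨h1, h2⟩ := hf γ 0 t ht.1 (hγ.mono (Icc_subset_Icc_right ht.2)) hm
  rw [← pathELength_add ht.1 ht.2, ← h2]
  exact add_le_add (edist_le_pathELength ht.1 h1)
    (edist_le_pathELength ht.2 (hγ.mono (Icc_subset_Icc_left ht.1)))

theorem PreservesPathLengthOn.dist_lt_or_exists_mem {f : M → N} {U : Set M}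
    (hf : PreservesPathLengthOn I f Uᶜ) {x y : M} {r : ℝ} (h : dist x y < r) :
    dist (f x) (f y) < r ∨ ∃ u ∈ U, dist x u + dist u y < r := by
  obtain ⟨γ, rfl, rfl, hγ, hr⟩ := exists_path_of_dist_lt I h
  by_cases hm : MapsTo γ (Icc 0 1) Uᶜ
  · left
    obtain ⟨h1, h2⟩ := hf γ 0 1 zero_le_one hγ hm
    have := (edist_le_pathELength zero_le_one h1).trans_lt (h2.trans_lt hr)
    rw [edist_dist] at this
    exact (ENNReal.ofReal_lt_ofReal_iff_of_nonneg dist_nonneg).1 this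
  · right
    simp only [MapsTo, not_forall, mem_compl_iff, not_not] at hm
    obtain ⟨t, ht, htU⟩ := hm
    refine ⟨γ t, htU, dist_add_dist_lt_of_edist (lt_of_le_of_lt ?_ hr)⟩
    rw [← pathELength_add ht.1 ht.2]
    exact add_le_add (edist_le_pathELength ht.1 (hγ.mono (Icc_subset_Icc_right ht.2)))
      (edist_le_pathELength ht.2 (hγ.mono (Icc_subset_Icc_left ht.1)))

end RiemannianPaths

/-! ### Minimal geodesics in a compact Riemannian manifold -/

open Manifold in
/-- Points along an almost minimizing path form a minimal geodesic up to an error `ε`. -/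
theorem exists_almost_geodesic {H : Type*} [TopologicalSpace H]
    (I : ModelWithCorners ℝ (EuclideanSpace ℝ (Fin 3)) H)
    {M : Type*} [MetricSpace M] [ChartedSpace H M]
    [Bundle.RiemannianBundle (fun x : M => TangentSpace I x)] [IsRiemannianManifold I M]
    (p q : M) {ε : ℝ} (hε : 0 < ε) :
    ∃ z : ℝ → M, z 0 = p ∧ z 1 = q ∧ ∀ s ∈ Icc (0 : ℝ) 1, ∀ t ∈ Icc (0 : ℝ) 1,
      dist (z s) (z t) ≤ |s - t| * dist p q + ε := by
  obtain ⟨γ, rfl, rfl, hγ, hr⟩ := exists_path_of_dist_lt I (lt_add_of_pos_right (dist p q) hε)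
  set d := dist (γ 0) (γ 1) with hd
  have hcont : ContinuousOn (fun t => dist (γ 0) (γ t)) (Icc 0 1) :=
    continuous_dist.comp_continuousOn (continuousOn_const.prodMk hγ.continuousOn)
  -- The path is reparametrized by distance from its start. The endpoints are prescribed separately,
  -- since a point at distance `d` from the start need not be `γ 1`.
  have hex : ∀ s : ℝ, ∃ t, s ∈ Icc (0 : ℝ) 1 → t ∈ Icc (0 : ℝ) 1 ∧ dist (γ 0) (γ t) = s * d ∧
      (s = 0 → t = 0) ∧ (s = 1 → t = 1) := by
    intro s
    by_cases h0 : s = 0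
    · exact ⟨0, fun _ => ⟨by simp, by simp [h0], fun _ => rfl, fun h => by simp [h] at h0⟩⟩
    by_cases h1 : s = 1
    · exact ⟨1, fun _ => ⟨by simp, by simp [h1, hd], fun h => absurd h h0, fun _ => rfl⟩⟩
    by_cases hs : s ∈ Icc (0 : ℝ) 1
    · have hd0 : 0 ≤ d := dist_nonneg
      obtain ⟨t, ht, hts⟩ := intermediate_value_Icc zero_le_one hcont
        (show s * d ∈ Icc _ _ from ⟨by simpa using mul_nonneg hs.1 hd0,
          by simpa [hd] using mul_le_of_le_one_left hd0 hs.2⟩)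
      exact ⟨t, fun _ => ⟨ht, hts, fun h => absurd h h0, fun h => absurd h h1⟩⟩
    · exact ⟨0, fun h => absurd h hs⟩
  choose τ hτ using hex
  have key : ∀ a b : ℝ, 0 ≤ a → a ≤ b → b ≤ 1 →
      dist (γ 0) (γ a) + dist (γ a) (γ b) + dist (γ b) (γ 1) < d + ε := by
    intro a b ha hab hb
    have h1 := edist_le_pathELength ha (hγ.mono (Icc_subset_Icc_right (hab.trans hb)))
    have h2 := edist_le_pathELength hab (hγ.mono (Icc_subset_Icc ha hb))
    have h3 := edist_le_pathELength hb (hγ.mono (Icc_subset_Icc_left (ha.trans hab)))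
    have h4 := (add_le_add (add_le_add h1 h2) h3).trans_lt (by
      rwa [pathELength_add ha hab, pathELength_add (ha.trans hab) hb])
    rw [edist_dist, edist_dist, edist_dist, ← ENNReal.ofReal_add dist_nonneg dist_nonneg,
      ← ENNReal.ofReal_add (by positivity) dist_nonneg] at h4
    exact (ENNReal.ofReal_lt_ofReal_iff_of_nonneg (by positivity)).1 h4
  have main : ∀ s ∈ Icc (0 : ℝ) 1, ∀ t ∈ Icc (0 : ℝ) 1, s ≤ t →
      dist (γ (τ s)) (γ (τ t)) ≤ (t - s) * d + ε := by
    intro s hs t ht hst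
    obtain ⟨hs1, hs2, -⟩ := hτ s hs
    obtain ⟨ht1, ht2, -⟩ := hτ t ht
    have hd0 : 0 ≤ (t - s) * d := mul_nonneg (sub_nonneg.2 hst) dist_nonneg
    -- `τ` need not be monotone; if the order is reversed, `key` bounds the distance by `ε - (t - s)
    -- * d`, which is even smaller.
    rcases le_total (τ s) (τ t) with h | h
    · have h1 := key _ _ hs1.1 h ht1.2
      have h2 := dist_triangle (γ 0) (γ (τ t)) (γ 1)
      linarith
    · have h1 := key _ _ ht1.1 h hs1.2
      have h2 := dist_triangle (γ 0) (γ (τ s)) (γ 1)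
      rw [dist_comm (γ (τ t))] at h1
      linarith
  refine ⟨fun s => γ (τ s), by simp [(hτ 0 (by simp)).2.2.1 rfl],
    by simp [(hτ 1 (by simp)).2.2.2 rfl], fun s hs t ht => ?_⟩
  rcases le_total s t with h | h
  · rw [abs_of_nonpos (by linarith), neg_sub]
    exact main s hs t ht h
  · rw [abs_of_nonneg (by linarith), dist_comm]
    exact main t ht s hs h

/-- Almost geodesics with error `1 / (n + 1)` converge pointwise along an ultrafilter, at all times
at once, so no equicontinuity is needed. -/
theorem exists_isMinimalGeodesic {H : Type*} [TopologicalSpace H]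
    (I : ModelWithCorners ℝ (EuclideanSpace ℝ (Fin 3)) H)
    {M : Type*} [MetricSpace M] [ChartedSpace H M]
    [Bundle.RiemannianBundle (fun x : M => TangentSpace I x)] [IsRiemannianManifold I M]
    [CompactSpace M] (p q : M) :
    ∃ γ : ℝ → M, IsMinimalGeodesic γ p q := by
  choose z hz0 hz1 hz using fun n : ℕ =>
    exists_almost_geodesic I p q (Nat.one_div_pos_of_nat (α := ℝ) (n := n))
  have hlim : ∀ s, ∃ w, Tendsto (fun n => z n s) (hyperfilter ℕ) (𝓝 w) := fun s => by
    obtain ⟨w, -, hw⟩ := isCompact_univ.ultrafilter_le_nhds ((hyperfilter ℕ).map fun n => z n s)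
      (by simp)
    exact ⟨w, hw⟩
  choose γ hγ using hlim
  have h0 : γ 0 = p := tendsto_nhds_unique (hγ 0) (by simp [hz0])
  have h1 : γ 1 = q := tendsto_nhds_unique (hγ 1) (by simp [hz1])
  have hle : ∀ s ∈ Icc (0 : ℝ) 1, ∀ t ∈ Icc (0 : ℝ) 1,
      dist (γ s) (γ t) ≤ |s - t| * dist p q := by
    intro s hs t ht
    have h2 : Tendsto (fun n : ℕ => |s - t| * dist p q + 1 / ((n : ℝ) + 1)) (hyperfilter ℕ)
        (𝓝 (|s - t| * dist p q + 0)) :=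
      (tendsto_const_nhds.add tendsto_one_div_add_atTop_nhds_zero_nat).mono_left
        Nat.hyperfilter_le_atTop
    rw [add_zero] at h2
    exact le_of_tendsto_of_tendsto' ((hγ s).dist (hγ t)) h2 fun n => hz n s hs t ht
  have main : ∀ s ∈ Icc (0 : ℝ) 1, ∀ t ∈ Icc (0 : ℝ) 1, s ≤ t →
      dist (γ s) (γ t) = (t - s) * dist p q := by
    intro s hs t ht hst
    have a1 := hle 0 (by simp) s hs
    have a2 := hle s hs t ht
    have a3 := hle t ht 1 (by simp)
    rw [h0, abs_of_nonpos (by linarith [hs.1])] at a1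
    rw [abs_of_nonpos (by linarith)] at a2
    rw [h1, abs_of_nonpos (by linarith [ht.2])] at a3
    have a4 := dist_triangle4 p (γ s) (γ t) q
    linarith
  refine ⟨γ, h0, h1, fun s hs t ht => ?_⟩
  rcases le_total s t with h | h
  · rw [abs_of_nonpos (by linarith), neg_sub]
    exact main s hs t ht h
  · rw [abs_of_nonneg (by linarith), dist_comm]
    exact main t ht s hs h

/-! ### Distances and geodesics in the pulled space -/

section PulledSpaceGeodesics

theorem PulledSpace.dist_proj_proj {X : Type*} [MetricSpace X] (K : NonemptyCompacts X) (x y : X) :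
    dist (proj K x) (proj K y) =
      min (dist x y) (Metric.infDist x (K : Set X) + Metric.infDist y (K : Set X)) := by
  have hz {z : X} (hz : z ∈ K) : Metric.infDist z (K : Set X) = 0 := Metric.infDist_zero_of_mem hz
  by_cases hx : x ∈ K <;> by_cases hy : y ∈ K
  · rw [proj_of_mem K hx, proj_of_mem K hy, dist_self, hz hx, hz hy, add_zero,
      min_eq_right dist_nonneg]
  · rw [proj_of_mem K hx, proj_of_notMem K hy, hz hx, zero_add, min_eq_right]
    · rfl
    · rw [dist_comm]
      exact Metric.infDist_le_dist_of_mem hx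
  · rw [proj_of_notMem K hx, proj_of_mem K hy, hz hy, add_zero, min_eq_right]
    · rfl
    · exact Metric.infDist_le_dist_of_mem hy
  · rw [proj_of_notMem K hx, proj_of_notMem K hy]
    rfl

theorem PulledSpace.dist_basePoint_proj {X : Type*} [MetricSpace X] (K : NonemptyCompacts X)
    (x : X) : dist (basePoint K) (proj K x) = Metric.infDist x (K : Set X) := by
  obtain ⟨p, hp⟩ := K.nonempty
  rw [← proj_of_mem K hp, dist_proj_proj, Metric.infDist_zero_of_mem hp, zero_add, min_eq_right]
  rw [dist_comm]
  exact Metric.infDist_le_dist_of_mem hp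

/-- A minimal geodesic to `q` from a closest point of `K` projects to a minimal geodesic from the
base point. -/
theorem PulledSpace.exists_isMinimalGeodesic {X : Type*} [MetricSpace X] (K : NonemptyCompacts X)
    (hX : ∀ p q : X, ∃ γ : ℝ → X, IsMinimalGeodesic γ p q) (q : X) :
    ∃ γ : ℝ → PulledSpace K, IsMinimalGeodesic γ (basePoint K) (proj K q) := by
  obtain ⟨p, hp, hpq⟩ := K.isCompact.exists_infDist_eq_dist K.nonempty q
  obtain ⟨γ, h0, h1, hγ⟩ := hX p q
  rw [dist_comm] at hpq
  -- If `γ s` were closer to `K` than to `p`, then `q` would be closer to `K` than `dist p q`.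
  have hd : ∀ s ∈ Icc (0 : ℝ) 1, Metric.infDist (γ s) (K : Set X) = s * dist p q := by
    intro s hs
    refine le_antisymm ?_ ?_
    · have := hγ s hs 0 (by simp)
      rw [h0, sub_zero, abs_of_nonneg hs.1] at this
      exact this ▸ Metric.infDist_le_dist_of_mem hp
    · have h2 := hγ 1 (by simp) s hs
      rw [h1, abs_of_nonneg (by linarith [hs.2])] at h2
      have h3 := Metric.infDist_le_infDist_add_dist (s := (K : Set X)) (x := q) (y := γ s)
      linarith
  refine ⟨fun s => proj K (γ s), ?_, ?_, fun s hs t ht => ?_⟩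
  · simp only [h0]
    exact proj_of_mem K hp
  · simp only [h1]
  · rw [dist_basePoint_proj, dist_proj_proj, hd s hs, hd t ht, hγ s hs t ht, hpq, ← add_mul,
      min_eq_left]
    -- `|s - t| ≤ s + t`, so the detour through the base point is never shorter.
    refine mul_le_mul_of_nonneg_right (abs_le.2 ⟨?_, ?_⟩) dist_nonneg <;> linarith [hs.1, ht.1]

end PulledSpaceGeodesics

/-! ### From Riemannian to purely metric replacement -/

section MetricReplacement

/-- The closure is needed because paths enter `V` at frontier points; compactness excludes the
default value `0` of `Metric.diam` on unbounded sets. -/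
theorem dist_le_of_mem_closure {N : Type*} [MetricSpace N] [CompactSpace N] {V : Set N} {D : ℝ}
    (hD : Metric.diam V ≤ D) {a b : N} (ha : a ∈ closure V) (hb : b ∈ closure V) :
    dist a b ≤ D := by
  refine le_trans ?_ hD
  rw [← Metric.diam_closure]
  exact Metric.dist_le_diam_of_mem isClosed_closure.isCompact.isBounded ha hb

/-- The metric consequences, for length spaces `M` and `N`, of `N` being obtained from `M` by
replacing the open set `U` by the open set `V`: short paths can be followed through `e` until they
enter the region that is replaced. -/
structure IsMetricReplacement {M N : Type*} [MetricSpace M] [MetricSpace N]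
    (U : Set M) (V : Set N) (e : PartialEquiv M N) : Prop where
  source_eq : e.source = Uᶜ
  target_eq : e.target = Vᶜ
  isOpen_source_compl : IsOpen U
  isOpen_target_compl : IsOpen V
  frontier_eq : frontier V = e '' frontier U
  exists_mem_frontier : ∀ x ∉ U, ∀ y ∈ U, ∀ r, dist x y < r →
    ∃ a ∈ frontier U, dist (e x) (e a) + dist a y < r
  exists_mem_frontier_symm : ∀ x ∉ V, ∀ y ∈ V, ∀ r, dist x y < r →
    ∃ a ∈ frontier V, dist (e.symm x) (e.symm a) + dist a y < r
  dist_lt_or : ∀ x ∉ U, ∀ y ∉ U, ∀ r, dist x y < r →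
    dist (e x) (e y) < r ∨ ∃ u ∈ U, dist x u + dist u y < r
  dist_symm_lt_or : ∀ x ∉ V, ∀ y ∉ V, ∀ r, dist x y < r →
    dist (e.symm x) (e.symm y) < r ∨ ∃ v ∈ V, dist x v + dist v y < r

theorem IsReplacement.isMetricReplacement {H : Type*} [TopologicalSpace H]
    {I : ModelWithCorners ℝ (EuclideanSpace ℝ (Fin 3)) H}
    {M : Type*} [MetricSpace M] [ChartedSpace H M]
    [Bundle.RiemannianBundle (fun x : M => TangentSpace I x)] [IsRiemannianManifold I M]
    {N : Type*} [MetricSpace N] [ChartedSpace H N]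
    [Bundle.RiemannianBundle (fun x : N => TangentSpace I x)] [IsRiemannianManifold I N]
    {A : Set M} {A' : Set N} {e : PartialEquiv M N} (h : IsReplacement I A A' e) (hA : IsOpen A) :
    IsMetricReplacement A A' e := by
  have h1 := preservesPathLengthOn_of_isometric h.contMDiffOn h.isometric
  have h2 := h1.symm h.contMDiffOn_symm
  -- The frontier of `A'` is the image of that of the open set `A`, hence of points outside `A`, so
  -- it misses `A'`.
  have hA' : IsOpen A' := by
    refine disjoint_frontier_iff_isOpen.1 ?_
    rw [h.frontier_eq, disjoint_left]
    rintro _ ⟨x, hx, rfl⟩ hxA'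
    rw [hA.frontier_eq] at hx
    have : e x ∈ A'ᶜ := h.target_eq ▸ e.map_source (h.source_eq ▸ hx.2)
    exact this hxA'
  rw [h.source_eq] at h1
  rw [h.target_eq] at h2
  exact {
    source_eq := h.source_eq
    target_eq := h.target_eq
    isOpen_source_compl := hA
    isOpen_target_compl := hA'
    frontier_eq := h.frontier_eq
    exists_mem_frontier := fun _ hx _ hy _ hr => h1.exists_mem_frontier hA hx hy hr
    exists_mem_frontier_symm := fun _ hx _ hy _ hr => h2.exists_mem_frontier hA' hx hy hr
    dist_lt_or := fun _ _ _ _ _ hr => h1.dist_lt_or_exists_mem hr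
    dist_symm_lt_or := fun _ _ _ _ _ hr => h2.dist_lt_or_exists_mem hr }

/-! ### Comparison of distances in `N` and in the pulled space -/

namespace IsMetricReplacement

variable {M N : Type*} [MetricSpace M] [MetricSpace N] {A₀ : NonemptyCompacts M} {δ : ℝ}
  {V : Set N} {e : PartialEquiv M N}

section General

variable {U : Set M} (h : IsMetricReplacement U V e)

include h

theorem symm_notMem {x : N} (hx : x ∉ V) : e.symm x ∉ U := by
  have : e.symm x ∈ Uᶜ := h.source_eq ▸ e.map_target (h.target_eq ▸ hx)
  exact this

theorem map_notMem {x : M} (hx : x ∉ U) : e x ∉ V := by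
  have : e x ∈ Vᶜ := h.target_eq ▸ e.map_source (h.source_eq ▸ hx)
  exact this

theorem map_symm {x : N} (hx : x ∉ V) : e (e.symm x) = x := e.right_inv (h.target_eq ▸ hx)

theorem symm_map {x : M} (hx : x ∉ U) : e.symm (e x) = x := e.left_inv (h.source_eq ▸ hx)

theorem map_mem_closure {a : M} (ha : a ∈ frontier U) : e a ∈ closure V :=
  frontier_subset_closure (h.frontier_eq ▸ mem_image_of_mem e ha)

theorem notMem_of_mem_frontier {a : M} (ha : a ∈ frontier U) : a ∉ U := by
  rw [h.isOpen_source_compl.frontier_eq] at ha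
  exact ha.2

theorem symm_mem_frontier {a : N} (ha : a ∈ frontier V) : e.symm a ∈ frontier U := by
  rw [h.frontier_eq] at ha
  obtain ⟨x, hx, rfl⟩ := ha
  rwa [h.symm_map (h.notMem_of_mem_frontier hx)]

/-- With `V` empty, a path in `M` from a point of `e.symm '' univ` into `U` would cross the frontier
of `U`, whose image lies in `closure V`. -/
theorem nonempty_right [Nonempty N] (hU : U.Nonempty) : V.Nonempty := by
  by_contra hV
  rw [not_nonempty_iff_eq_empty] at hV
  obtain ⟨y, hy⟩ := hU
  obtain ⟨x⟩ := ‹Nonempty N›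
  obtain ⟨a, ha, -⟩ := h.exists_mem_frontier _ (h.symm_notMem (x := x) (by simp [hV])) y hy _
    (lt_add_one _)
  simpa [hV] using h.map_mem_closure ha

end General

variable (h : IsMetricReplacement (Metric.thickening δ (A₀ : Set M)) V e)

theorem le_infDist_of_notMem {x : M} (hx : x ∉ Metric.thickening δ (A₀ : Set M)) :
    δ ≤ Metric.infDist x (A₀ : Set M) := by
  rw [Metric.mem_thickening_iff_infDist_lt A₀.nonempty] at hx
  exact not_lt.1 hx

include h

/-- On the way to a nearest point of `A₀`, the last stretch inside the tube has length at least `δ`,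
which is saved. -/
theorem exists_mem_closure_dist_lt (hδ : 0 < δ) {x : N} (hx : x ∉ V) {r : ℝ} (hr : 0 < r) :
    ∃ a ∈ closure V, dist x a < Metric.infDist (e.symm x) (A₀ : Set M) - δ + r := by
  obtain ⟨y, hy, hxy⟩ := A₀.isCompact.exists_infDist_eq_dist A₀.nonempty (e.symm x)
  obtain ⟨a, ha, har⟩ := h.exists_mem_frontier _ (h.symm_notMem hx) y
    (Metric.self_subset_thickening hδ _ hy) _ (lt_add_of_pos_right _ hr)
  refine ⟨e a, h.map_mem_closure ha, ?_⟩
  rw [h.map_symm hx, ← hxy] at har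
  have h1 := le_infDist_of_notMem (h.notMem_of_mem_frontier ha)
  have h2 := Metric.infDist_le_dist_of_mem (x := a) hy
  linarith

/-- A path from `x` to `v` enters `V` at a point whose preimage is within `δ` of `A₀`. -/
theorem infDist_le {x v : N} (hx : x ∉ V) (hv : v ∈ V) :
    Metric.infDist (e.symm x) (A₀ : Set M) ≤ δ + dist x v := by
  refine le_of_forall_pos_lt_add fun r hr => ?_
  obtain ⟨a, ha, har⟩ := h.exists_mem_frontier_symm x hx v hv _ (lt_add_of_pos_right _ hr)
  have h1 := Metric.infDist_le_infDist_add_dist (s := (A₀ : Set M)) (x := e.symm x)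
    (y := e.symm a)
  have h2 : Metric.infDist (e.symm a) (A₀ : Set M) ≤ δ := by
    have h3 : closure (Metric.thickening δ (A₀ : Set M)) ⊆ {z | Metric.infDist z A₀ ≤ δ} :=
      closure_minimal (fun z hz =>
        ((Metric.mem_thickening_iff_infDist_lt A₀.nonempty).1 hz).le)
        (isClosed_le (Metric.continuous_infDist_pt _) continuous_const)
    exact h3 (frontier_subset_closure (h.symm_mem_frontier ha))
  have h3 : 0 ≤ dist a v := dist_nonneg
  linarith

theorem dist_regionMap_le (hδ : 0 < δ) {x y : N} (hx : x ∉ V) (hy : y ∉ V) :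
    dist (regionMap A₀ e x) (regionMap A₀ e y) ≤ dist x y + 2 * δ := by
  refine le_of_forall_pos_lt_add fun r hr => ?_
  rw [regionMap, regionMap, PulledSpace.dist_proj_proj, min_lt_iff]
  rcases h.dist_symm_lt_or x hx y hy _ (lt_add_of_pos_right _ hr) with h1 | ⟨v, hv, h1⟩
  · left
    linarith
  -- The path meets `V` at `v`, and each of its two legs reaches `A₀` at an extra cost of `δ`.
  · right
    have h2 := h.infDist_le hx hv
    have h3 := h.infDist_le hy hv
    rw [dist_comm y] at h3
    linarith

theorem dist_scrunchMap_regionMap_le {F : N → PulledSpace A₀} (hF : IsScrunchMap A₀ V e δ F)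
    (hδ : 0 < δ) {x : N} (hx : x ∉ V) :
    dist (F x) (regionMap A₀ e x) ≤ δ ∧
      dist (PulledSpace.basePoint A₀) (F x) ≤ Metric.infDist (e.symm x) (A₀ : Set M) := by
  by_cases hxt : x ∈ Metric.thickening δ V
  · obtain ⟨γ, ⟨h0, h1, hγ⟩, hFx⟩ := hF.between x ⟨hxt, hx⟩
    obtain ⟨v, hv, hxv⟩ := Metric.mem_thickening_iff.1 hxt
    have hle := le_infDist_of_notMem (h.symm_notMem hx)
    have hlt := h.infDist_le hx hv
    rw [regionMap, PulledSpace.dist_basePoint_proj] at hFx hγ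
    set ρ := Metric.infDist (e.symm x) (A₀ : Set M) with hρ
    have hs0 : 0 ≤ (ρ - δ) / δ := div_nonneg (by linarith) hδ.le
    have hs1 : (ρ - δ) / δ ≤ 1 := (div_le_one hδ).2 (by linarith)
    have hs : (ρ - δ) / δ * δ = ρ - δ := div_mul_cancel₀ _ hδ.ne'
    set s := (ρ - δ) / δ
    have h2 := hγ s ⟨hs0, hs1⟩ 1 (by simp)
    have h3 := hγ 0 (by simp) s ⟨hs0, hs1⟩
    rw [h1, abs_of_nonpos (by linarith)] at h2
    rw [h0, abs_of_nonpos (by linarith)] at h3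
    rw [hFx, h2, h3]
    -- With `s = (ρ - δ) / δ`, the distance from `F x` to `P x` is `(1 - s) * ρ = (δ ^ 2 - (ρ - δ) ^
    -- 2) / δ ≤ δ`.
    constructor <;> nlinarith
  · rw [hF.outer x hxt, dist_self, regionMap, PulledSpace.dist_basePoint_proj]
    exact ⟨hδ.le, le_rfl⟩

variable {D : ℝ} [CompactSpace N]

theorem dist_le_infDist_add (hδ : 0 < δ) (hD : Metric.diam V ≤ D) {x v : N} (hx : x ∉ V)
    (hv : v ∈ V) : dist x v ≤ Metric.infDist (e.symm x) (A₀ : Set M) - δ + D := by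
  refine le_of_forall_pos_lt_add fun r hr => ?_
  obtain ⟨a, ha, har⟩ := h.exists_mem_closure_dist_lt hδ hx hr
  have h1 := dist_le_of_mem_closure hD ha (subset_closure hv)
  have h2 := dist_triangle x a v
  linarith

theorem dist_le_dist_regionMap (hδ : 0 < δ) (hD : Metric.diam V ≤ D) {x y : N} (hx : x ∉ V)
    (hy : y ∉ V) (hD0 : 0 ≤ D) :
    dist x y ≤ dist (regionMap A₀ e x) (regionMap A₀ e y) + D := by
  rw [regionMap, regionMap, PulledSpace.dist_proj_proj, ← sub_le_iff_le_add]
  refine le_min ?_ ?_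
  · refine le_of_forall_pos_lt_add fun r hr => ?_
    rcases h.dist_lt_or _ (h.symm_notMem hx) _ (h.symm_notMem hy) _
      (lt_add_of_pos_right _ (half_pos hr)) with h1 | ⟨u, hu, h1⟩
    · rw [h.map_symm hx, h.map_symm hy] at h1
      linarith
    -- Both ends are followed towards `u` until they enter the tube; the gap between the entrance
    -- points costs at most `D` in `N`.
    · obtain ⟨a, ha, har⟩ := h.exists_mem_frontier _ (h.symm_notMem hx) u hu _
        (lt_add_of_pos_right _ (show 0 < r / 4 by positivity))
      obtain ⟨b, hb, hbr⟩ := h.exists_mem_frontier _ (h.symm_notMem hy) u hu _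
        (lt_add_of_pos_right _ (show 0 < r / 4 by positivity))
      rw [h.map_symm hx] at har
      rw [h.map_symm hy, dist_comm y, dist_comm (e.symm y)] at hbr
      have h2 := dist_le_of_mem_closure hD (h.map_mem_closure ha) (h.map_mem_closure hb)
      have h3 := dist_triangle4 x (e a) (e b) y
      have h4 : 0 ≤ dist a u := dist_nonneg
      have h5 : 0 ≤ dist b u := dist_nonneg
      linarith
  · refine le_of_forall_pos_lt_add fun r hr => ?_
    obtain ⟨a, ha, har⟩ := h.exists_mem_closure_dist_lt hδ hx (half_pos hr)
    obtain ⟨b, hb, hbr⟩ := h.exists_mem_closure_dist_lt hδ hy (half_pos hr)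
    have h2 := dist_le_of_mem_closure hD ha hb
    have h3 := dist_triangle4 x a b y
    rw [dist_comm y] at hbr
    linarith

theorem isAlmostIsometry [Nonempty N] {F : N → PulledSpace A₀}
    (hF : IsScrunchMap A₀ V e δ F) (hδ : 0 < δ) (hD : Metric.diam V ≤ D)
    (hδD : 2 * δ < D) : IsAlmostIsometry (D + 2 * δ) F := by
  have hmix : ∀ v ∈ V, ∀ y ∉ V, |dist (F v) (F y) - dist v y| ≤ D + 2 * δ := by
    intro v hv y hy
    obtain ⟨h1, h2⟩ := h.dist_scrunchMap_regionMap_le hF hδ hy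
    have h3 := h.dist_le_infDist_add hδ hD hy hv
    have h4 := h.infDist_le hy hv
    have h5 := dist_triangle (PulledSpace.basePoint A₀) (F y) (regionMap A₀ e y)
    rw [regionMap, PulledSpace.dist_basePoint_proj, ← regionMap] at h5
    rw [hF.inner v hv, dist_comm v, abs_le]
    constructor <;> linarith
  refine ⟨fun x y => ?_, fun q => ?_⟩
  · by_cases hx : x ∈ V <;> by_cases hy : y ∈ V
    · have h1 := dist_le_of_mem_closure hD (subset_closure hx) (subset_closure hy)
      rw [hF.inner x hx, hF.inner y hy, dist_self, zero_sub, abs_neg, abs_of_nonneg dist_nonneg]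
      linarith
    · exact hmix x hx y hy
    · rw [dist_comm (F x), dist_comm x]
      exact hmix y hy x hx
    · have h1 := (h.dist_scrunchMap_regionMap_le hF hδ hx).1
      have h2 := (h.dist_scrunchMap_regionMap_le hF hδ hy).1
      have h3 := h.dist_regionMap_le hδ hx hy
      have h4 := h.dist_le_dist_regionMap hδ hD hx hy (by linarith)
      have h5 := dist_triangle4 (F x) (regionMap A₀ e x) (regionMap A₀ e y) (F y)
      have h6 := dist_triangle4 (regionMap A₀ e x) (F x) (F y) (regionMap A₀ e y)
      rw [dist_comm _ (F x)] at h6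
      rw [dist_comm (regionMap A₀ e y)] at h5
      rw [abs_le]
      constructor <;> linarith
  · obtain ⟨x, rfl⟩ := PulledSpace.proj_surjective A₀ q
    rw [Metric.mem_thickening_iff]
    by_cases hx : x ∈ Metric.thickening δ (A₀ : Set M)
    -- Points of the tube project to within `δ` of the base point, which is the value of `F` on `V`.
    · obtain ⟨v, hv⟩ := h.nonempty_right ⟨x, hx⟩
      refine ⟨F v, mem_range_self v, ?_⟩
      rw [hF.inner v hv, dist_comm, PulledSpace.dist_basePoint_proj]
      have := (Metric.mem_thickening_iff_infDist_lt A₀.nonempty).1 hx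
      linarith
    · refine ⟨F (e x), mem_range_self _, ?_⟩
      have := (h.dist_scrunchMap_regionMap_le hF hδ (h.map_notMem hx)).1
      rw [regionMap, h.symm_map hx, dist_comm] at this
      linarith

end IsMetricReplacement

/-! ### Existence of the maps and Gromov–Hausdorff convergence -/

open Classical in
theorem exists_isScrunchMap {M N : Type*} [MetricSpace M] [MetricSpace N]
    (hM : ∀ p q : M, ∃ γ : ℝ → M, IsMinimalGeodesic γ p q) (A₀ : NonemptyCompacts M)
    (V : Set N) (e : PartialEquiv M N) {δ : ℝ} (hδ : 0 < δ) :
    ∃ F : N → PulledSpace A₀, IsScrunchMap A₀ V e δ F := by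
  choose γ hγ using fun x : N => PulledSpace.exists_isMinimalGeodesic A₀ hM (e.symm x)
  refine ⟨fun x => if x ∈ V then PulledSpace.basePoint A₀ else
    if x ∈ Metric.thickening δ V then
      γ x ((dist (PulledSpace.basePoint A₀) (regionMap A₀ e x) - δ) / δ)
    else regionMap A₀ e x, ⟨fun x hx => ?_, fun x hx => if_pos hx, fun x hx => ?_⟩⟩
  · simp only [if_neg hx, if_neg fun h => hx (Metric.self_subset_thickening hδ V h)]
  · exact ⟨γ x, hγ x, by simp only [if_neg hx.2, if_pos hx.1]⟩

/-- The distortion `η` of `F` contributes `η / 2`, and the `η`-density of its image contributes `η`.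
-/
theorem IsAlmostIsometry.ghDist_le {X Y : Type*} [MetricSpace X] [CompactSpace X] [Nonempty X]
    [MetricSpace Y] [CompactSpace Y] [Nonempty Y] {η : ℝ} {F : X → Y}
    (hF : IsAlmostIsometry η F) : GromovHausdorff.ghDist X Y ≤ η / 2 + η := by
  have := GromovHausdorff.ghDist_le_of_approx_subsets (s := (univ : Set X)) (fun x => F x)
    (ε₁ := 0) (ε₂ := η) (ε₃ := η) (fun x => ⟨x, mem_univ x, by simp⟩) (fun y => ?_)
    (fun x y => ?_)
  · linarith
  · obtain ⟨_, ⟨x, rfl⟩, hx⟩ := Metric.mem_thickening_iff.1 (hF.2 y)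
    exact ⟨⟨x, mem_univ x⟩, hx.le⟩
  · rw [abs_sub_comm]
    exact hF.1 x y

end MetricReplacement

theorem lemma5p4 {H : Type*} [TopologicalSpace H]
    (I : ModelWithCorners ℝ (EuclideanSpace ℝ (Fin 3)) H)
    -- the compact Riemannian three-manifold `M`, possibly with boundary
    {M : Type*} [MetricSpace M] [CompactSpace M] [ChartedSpace H M] [IsManifold I ∞ M]
    [Bundle.RiemannianBundle (fun x : M => TangentSpace I x)]
    [IsContMDiffRiemannianBundle I ∞ (EuclideanSpace ℝ (Fin 3)) (fun x : M => TangentSpace I x)]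
    [IsRiemannianManifold I M] [MeasurableSpace M] [BorelSpace M]
    -- the compact Riemannian three-manifolds `N j`, possibly with boundary
    {N : ℕ → Type*} [∀ j, MetricSpace (N j)] [∀ j, CompactSpace (N j)] [∀ j, Nonempty (N j)]
    [∀ j, ChartedSpace H (N j)] [∀ j, IsManifold I ∞ (N j)]
    [∀ j, Bundle.RiemannianBundle (fun x : N j => TangentSpace I x)]
    [∀ j, IsContMDiffRiemannianBundle I ∞ (EuclideanSpace ℝ (Fin 3))
      (fun x : N j => TangentSpace I x)]
    [∀ j, IsRiemannianManifold I (N j)] [∀ j, MeasurableSpace (N j)] [∀ j, BorelSpace (N j)]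
    (A₀ : TopologicalSpace.NonemptyCompacts M)
    (A' : ∀ j, Set (N j)) (e : ∀ j, PartialEquiv M (N j)) (δ ε D : ℕ → ℝ)
    (hN : IsScrunching I A₀ A' e δ ε D) :
    (∀ j, ∃ F : N j → PulledSpace A₀, IsScrunchMap A₀ (A' j) (e j) (δ j) F) ∧
    (∀ j, ∀ F : N j → PulledSpace A₀, IsScrunchMap A₀ (A' j) (e j) (δ j) F →
      IsAlmostIsometry (D j + 2 * δ j) F) ∧
    Tendsto (fun j => D j + 2 * δ j) atTop (𝓝 0) ∧
    Tendsto (fun j => GromovHausdorff.ghDist (N j) (PulledSpace A₀)) atTop (𝓝 0) := by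
  have hR j := (hN.replacement j).isMetricReplacement Metric.isOpen_thickening
  have hex j : ∃ F : N j → PulledSpace A₀, IsScrunchMap A₀ (A' j) (e j) (δ j) F :=
    exists_isScrunchMap (exists_isMinimalGeodesic I) A₀ (A' j) (e j) (hN.delta_pos j)
  have hiso j (F : N j → PulledSpace A₀) (hF : IsScrunchMap A₀ (A' j) (e j) (δ j) F) :
      IsAlmostIsometry (D j + 2 * δ j) F :=
    (hR j).isAlmostIsometry hF (hN.delta_pos j) (hN.diam_le j) (hN.two_delta_lt j)
  have hδ : Tendsto (fun j => 2 * δ j) atTop (𝓝 0) :=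
    squeeze_zero (fun j => by have := hN.delta_pos j; positivity)
      (fun j => (hN.two_delta_lt j).le) hN.tendsto_diam
  have hη : Tendsto (fun j => D j + 2 * δ j) atTop (𝓝 0) := by
    simpa using hN.tendsto_diam.add hδ
  refine ⟨hex, hiso, hη, squeeze_zero (fun j => dist_nonneg) (fun j => ?_)
    (by simpa using (hη.div_const 2).add hη)⟩
  obtain ⟨F, hF⟩ := hex j
  exact (hiso j F hF).ghDist_le
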